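/- Fix the following conventions. A partial function $F\colon\subseteq\omega^\omega\to\omega^\omega$ is computable if a single oracle program, given oracle $x\in\mathrm{dom}(F)$ and input $n$, outputs $F(x)(n)$. A representation of a set $X$ is a partial surjection $\delta_X\colon\subseteq\omega^\omega\to X$; if $\delta_X(p)=x$, then $p$ is a name of $x$. For partial multivalued functions $f\colon\subseteq X\rightrightarrows Y$ and $g\colon\subseteq Z\rightrightarrows W$ between represented spaces, $f\leq_{\sf W}g$ (Weihrauch reducibility) means that there are partial computable functions $h,k$ such that, whenever $p$ is a name of some $x\in\mathrm{dom}(f)$, $h(p)$ is defined and is a name of some $z\in\mathrm{dom}(g)$, and for every name $r$ of an element of $g(z)$, $k(p,r)$ is defined and is a name of an element of $f(x)$. Write $f\equiv_{\sf W}g$ if $f\leq_{\sf W}g$ and $g\leq_{\sf W}f$. The set $\omega$ is represented by $p\mapsto p(0)$. For $\Gamma\in\{\Pi^1_1,\Sigma^1_1\}$, let $\boldsymbol{\Gamma}(\omega)$ be the collection of all boldface $\boldsymbol{\Gamma}$ subsets of $\omega$ (those which are $\Gamma(p)$ for some $p\in\omega^\omega$), with the total representation in which $e^\frown p$ is a name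 of the $e$-th $\Gamma(p)$ subset of $\omega$. Here the $e$-th $\Pi^1_1(p)$ set is $$\{n : \forall f\in\omega^\omega\ \exists k\ \ (n,f{\upharpoonright}k,p{\upharpoonright}k)\in W_e\},$$ where $W_e$ is the $e$-th computably enumerable set (of codes of triples), and the $e$-th $\Sigma^1_1(p)$ set is its complement. Let $\Gamma\text{-}{\sf LNP}\colon\subseteq\boldsymbol{\Gamma}(\omega)\to\omega$ be the partial function that maps each nonempty $A$ to $\min A$ and is undefined at $\emptyset$. Let $\#\Gamma\colon\subseteq\boldsymbol{\Gamma}(\omega)\to\omega$ be the partial function that maps each finite $A$ to its cardinality $\#A$ and is undefined at infinite $A$. Proposition. $\Pi^1_1\text{-}{\sf LNP}\equiv_{\sf W}\#\Sigma^1_1$ and $\Sigma^1_1\text{-}{\sf LNP}\equiv_{\sf W}\#\Pi^1_1$. -/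

import Mathlib

/-- The Baire space `ω^ω`. -/
abbrev Baire : Type := ℕ → ℕ

namespace Baire

/-- The initial segment `x ↾ k = ⟨x 0, …, x (k - 1)⟩`. -/
def restrict (x : Baire) (k : ℕ) : List ℕ := (List.range k).map x

/-- The concatenation `e ⌢ p`. -/
def cons (e : ℕ) (p : Baire) : Baire := fun i => Nat.casesOn i e p

/-- The sequence `x` without its first entry. -/
def tail (x : Baire) : Baire := fun i => x (i + 1)

/-- The usual computable pairing `ω^ω × ω^ω ≃ ω^ω`: `x` on the even and `y` on the odd places. -/
def join (x y : Baire) : Baire := fun i => if i % 2 = 0 then x (i / 2) else y (i / 2)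

end Baire

/-! ### Computable functions on Baire space -/

/-- `OracleComputable Φ`: the operation `x ↦ Φ x`, taking an oracle `x ∈ ω^ω` to a partial function
`Φ x : ω ⇀ ω`, is computed by one oracle program, the same for all oracles.  The clauses are those
of `Nat.RecursiveIn`, uniformly in the oracle. -/
inductive OracleComputable : (Baire → ℕ →. ℕ) → Prop
  | zero : OracleComputable fun _ _ => Part.some 0
  | succ : OracleComputable fun _ n => Part.some (n + 1)
  | left : OracleComputable fun _ n => Part.some n.unpair.1
  | right : OracleComputable fun _ n => Part.some n.unpair.2
  | oracle : OracleComputable fun x n => Part.some (x n)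
  | pair {Φ Ψ : Baire → ℕ →. ℕ} (hΦ : OracleComputable Φ) (hΨ : OracleComputable Ψ) :
      OracleComputable fun x n => Nat.pair <$> Φ x n <*> Ψ x n
  | comp {Φ Ψ : Baire → ℕ →. ℕ} (hΦ : OracleComputable Φ) (hΨ : OracleComputable Ψ) :
      OracleComputable fun x n => Ψ x n >>= Φ x
  | prec {Φ Ψ : Baire → ℕ →. ℕ} (hΦ : OracleComputable Φ) (hΨ : OracleComputable Ψ) :
      OracleComputable fun x a =>
        Nat.rec (Φ x a.unpair.1)
          (fun y IH => IH >>= fun i => Ψ x (Nat.pair a.unpair.1 (Nat.pair y i))) a.unpair.2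
  | rfind {Φ : Baire → ℕ →. ℕ} (hΦ : OracleComputable Φ) :
      OracleComputable fun x a =>
        Nat.rfind fun n => (fun m => decide (m = 0)) <$> Φ x (Nat.pair a n)

/-- A partial function `F : ⊆ ω^ω → ω^ω` is computable if one oracle program, with oracle `x` and
input `n`, computes the value `F x n`; `F x` is defined just in case the program halts with oracle
`x` on every input. -/
def BairePartComputable (F : Baire →. Baire) : Prop :=
  ∃ Φ : Baire → ℕ →. ℕ, OracleComputable Φ ∧ ∀ x y, y ∈ F x ↔ ∀ n, y n ∈ Φ x n

/-! ### Represented spaces and Weihrauch reducibility -/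

/-- A representation of `X`: a partial surjection `δ : ⊆ ω^ω → X`.  If `x ∈ δ p`, i.e. `δ p = x`,
then `p` is a name of `x`. -/
class RepresentedSpace (X : Type*) where
  δ : Baire →. X
  surj : ∀ x : X, ∃ p : Baire, x ∈ δ p

/-- A partial multivalued function `f : ⊆ X ⇉ Y`: its domain (the instances) and, for each
instance, its set of values (the solutions).  Values outside of the domain are irrelevant. -/
structure MultiFun (X Y : Type*) where
  dom : Set X
  val : X → Set Y

/-- A partial (single-valued) function, as a partial multivalued function. -/
def MultiFun.ofPart {X Y : Type*} (f : X →. Y) : MultiFun X Y where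
  dom := f.Dom
  val := fun x => {y | y ∈ f x}

/-- Weihrauch reducibility `f ≤_W g`: there are partial computable `h` (inner reduction) and `k`
(outer reduction) such that for each name `p` of an instance `x` of `f`, `h p` is a name of an
instance `z` of `g`, and for each name `r` of a solution `w` to the instance `z` of `g`,
`k (p, r)` is a name of a solution to the instance `x` of `f`. -/
def WeihrauchLE {X Y Z W : Type*} [RepresentedSpace X] [RepresentedSpace Y] [RepresentedSpace Z]
    [RepresentedSpace W] (f : MultiFun X Y) (g : MultiFun Z W) : Prop :=
  ∃ h k : Baire →. Baire, BairePartComputable h ∧ BairePartComputable k ∧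
    ∀ (p : Baire) (x : X), x ∈ RepresentedSpace.δ p → x ∈ f.dom →
      ∃ q ∈ h p, ∃ z : Z, z ∈ RepresentedSpace.δ q ∧ z ∈ g.dom ∧
        ∀ (r : Baire) (w : W), w ∈ RepresentedSpace.δ r → w ∈ g.val z →
          ∃ s ∈ k (Baire.join p r), ∃ y : Y, y ∈ RepresentedSpace.δ s ∧ y ∈ f.val x

/-- Weihrauch equivalence `f ≡_W g`. -/
def WeihrauchEquiv {X Y Z W : Type*} [RepresentedSpace X] [RepresentedSpace Y]
    [RepresentedSpace Z] [RepresentedSpace W] (f : MultiFun X Y) (g : MultiFun Z W) : Prop :=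
  WeihrauchLE f g ∧ WeihrauchLE g f

/-- The standard representation of `ω`: `p` is a name of `p 0`. -/
instance RepresentedSpace.instNat : RepresentedSpace ℕ where
  δ := fun p => Part.some (p 0)
  surj := fun n => ⟨fun _ => n, Part.mem_some n⟩

/-! ### The spaces of `Π¹₁` and of `Σ¹₁` subsets of `ω` -/

/-- The `e`-th computably enumerable set `W_e ⊆ ω`, the domain of the `e`-th partial computable
function. -/
def ceSet (e : ℕ) : Set ℕ := {m | ((Denumerable.ofNat Nat.Partrec.Code e).eval m).Dom}

/-- The `e`-th semirecursive (lightface `Σ⁰₁`) subset of `ω × ω^ω × ω^ω`: the union of the basic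
open sets `{(n, f, p) | σ ⊂ f, τ ⊂ p}` such that `(n, σ, τ) ∈ W_e` (where `|σ| = |τ|`). -/
def sigma01Set (e : ℕ) : Set (ℕ × Baire × Baire) :=
  {t | ∃ k : ℕ, Encodable.encode (t.1, t.2.1.restrict k, t.2.2.restrict k) ∈ ceSet e}

/-- The `e`-th `Π¹₁(p)` subset of `ω`. -/
def pi11Set (e : ℕ) (p : Baire) : Set ℕ := {n | ∀ f : Baire, (n, f, p) ∈ sigma01Set e}

/-- The `e`-th `Σ¹₁(p)` subset of `ω`. -/
def sigma11Set (e : ℕ) (p : Baire) : Set ℕ := {n | ∃ f : Baire, (n, f, p) ∉ sigma01Set e}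

/-- The collection of all boldface `Π¹₁` subsets of `ω`. -/
def BoldPi11 : Type := {A : Set ℕ // ∃ (e : ℕ) (p : Baire), A = pi11Set e p}

/-- The collection of all boldface `Σ¹₁` subsets of `ω`. -/
def BoldSigma11 : Type := {A : Set ℕ // ∃ (e : ℕ) (p : Baire), A = sigma11Set e p}

/-- The total representation of the `Π¹₁` sets: `e ⌢ p` is a name of the `e`-th `Π¹₁(p)` set. -/
instance BoldPi11.instRepresentedSpace : RepresentedSpace BoldPi11 where
  δ := fun x => Part.some ⟨pi11Set (x 0) x.tail, x 0, x.tail, rfl⟩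
  surj := by
    rintro ⟨A, e, p, rfl⟩
    exact ⟨Baire.cons e p, Part.mem_some _⟩

/-- The total representation of the `Σ¹₁` sets: `e ⌢ p` is a name of the `e`-th `Σ¹₁(p)` set. -/
instance BoldSigma11.instRepresentedSpace : RepresentedSpace BoldSigma11 where
  δ := fun x => Part.some ⟨sigma11Set (x 0) x.tail, x 0, x.tail, rfl⟩
  surj := by
    rintro ⟨A, e, p, rfl⟩
    exact ⟨Baire.cons e p, Part.mem_some _⟩

/-! ### The least number and counting principles -/

/-- `A ↦ min A`, defined if `A ≠ ∅`. -/
noncomputable def leastNumber : Set ℕ →. ℕ := fun A => ⟨A.Nonempty, fun _ => sInf A⟩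

/-- `A ↦ #A`, defined if `A` is finite. -/
noncomputable def counting : Set ℕ →. ℕ := fun A => ⟨A.Finite, fun _ => A.ncard⟩

/-- `Π¹₁-LNP`. -/
noncomputable def pi11LNP : MultiFun BoldPi11 ℕ := MultiFun.ofPart fun A => leastNumber A.1

/-- `Σ¹₁-LNP`. -/
noncomputable def sigma11LNP : MultiFun BoldSigma11 ℕ := MultiFun.ofPart fun A => leastNumber A.1

/-- `#Π¹₁`. -/
noncomputable def pi11Counting : MultiFun BoldPi11 ℕ := MultiFun.ofPart fun A => counting A.1

/-- `#Σ¹₁`. -/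
noncomputable def sigma11Counting : MultiFun BoldSigma11 ℕ := MultiFun.ofPart fun A => counting A.1

/-! ### Computable operations on Baire space -/

/-! For nonempty `A`, `min A` is the number of `n` such that no `m ≤ n` is in `A`; for finite `A`,
`#A` is the least `n` with `#A ≤ n`. Both derived sets lie in the class dual to that of `A`: `#A >
n` is witnessed by `n + 1` distinct elements of `A`, and `#A ≤ n` by at most `n` numbers outside
which `A` has no element. So each reduction passes to a derived set with exactly the same answer.
Uniformity comes from `exists_sigma11Set_eq`: each condition or its negation reads `∃ a, E n a ∧ ∀
m, D n a m → m ∈ S`, where `S` is the given set or its complement, and one index `c` defines the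
result from the whole name `e ⌢ p`. Prefixing `c` is then the entire inner reduction
(`weihrauchLE_of_cons`). -/

theorem OracleComputable.of_partrec {f : ℕ →. ℕ} (hf : Nat.Partrec f) :
    OracleComputable fun _ => f := by
  induction hf with
  | zero => exact .zero
  | succ => exact .succ
  | left => exact .left
  | right => exact .right
  | pair _ _ hf hg => exact .pair hf hg
  | comp _ _ hf hg => exact .comp hf hg
  | prec _ _ hf hg => exact .prec hf hg
  | rfind _ hf => exact .rfind hf

theorem OracleComputable.of_primrec {f : ℕ → ℕ} (hf : Nat.Primrec f) :
    OracleComputable fun _ n => Part.some (f n) :=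
  .of_partrec (.of_primrec hf)

/-- A total operation on Baire space computed by an oracle program is computable. -/
theorem OracleComputable.bairePartComputable {F : Baire → Baire}
    (hF : OracleComputable fun x n => Part.some (F x n)) :
    BairePartComputable fun x => Part.some (F x) :=
  ⟨_, hF, fun x y => by simp [funext_iff]⟩

theorem oracleComputable_cons (c : ℕ) :
    OracleComputable fun x n => Part.some (Baire.cons c x n) := by
  -- The recursion step ignores the previous value and queries the oracle at the stage `y`, so stage
  -- `n + 1` returns `x n`.
  have hstep := OracleComputable.oracle.comp (.comp .left .right)
  have hrec := (OracleComputable.of_primrec (.const c)).prec hstep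
  have hpair : OracleComputable fun _ n => Part.some (Nat.pair 0 n) :=
    .of_primrec (Nat.Primrec.zero.pair .id)
  refine (congrArg OracleComputable (funext₂ fun x n => ?_)).mp (hrec.comp hpair)
  simp only [Part.bind_eq_bind, Part.bind_some, Nat.unpair_pair]
  induction n with
  | zero => rfl
  | succ n ih => simp only [ih, Part.bind_some]; rfl

theorem oracleComputable_const_apply (i : ℕ) :
    OracleComputable fun x _ => Part.some (x i) := by
  simpa using OracleComputable.oracle.comp (.of_primrec (.const i))

/-- Prefixing a fixed number to the names of the instances of `f` yields a reduction to `g`, if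
the resulting instances of `g` have only solutions to the given instances of `f`. -/
theorem weihrauchLE_of_cons {X Z : Type*} [RepresentedSpace X] [RepresentedSpace Z]
    {f : MultiFun X ℕ} {g : MultiFun Z ℕ} (c : ℕ)
    (h : ∀ (p : Baire) (x : X), x ∈ RepresentedSpace.δ p → x ∈ f.dom →
      ∃ z : Z, z ∈ RepresentedSpace.δ (Baire.cons c p) ∧ z ∈ g.dom ∧ g.val z ⊆ f.val x) :
    WeihrauchLE f g := by
  -- Entry `1` of `Baire.join p r` is `r 0`, the solution named by `r`.
  refine ⟨_, _, (oracleComputable_cons c).bairePartComputable,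
    (oracleComputable_const_apply 1).bairePartComputable (F := fun y _ => y 1), ?_⟩
  intro p x hx hfx
  obtain ⟨z, hz, hgz, hsub⟩ := h p x hx hfx
  refine ⟨_, Part.mem_some _, z, hz, hgz, fun r w hw hgw => ⟨_, Part.mem_some _, w, ?_, hsub hgw⟩⟩
  rw [Part.mem_some_iff.1 hw]
  exact Part.mem_some _

/-! ### Uniform closure properties of `Σ¹₁` and `Π¹₁` -/

theorem mem_pi11Set_iff {e : ℕ} {p : Baire} {n : ℕ} : n ∈ pi11Set e p ↔ n ∉ sigma11Set e p := by
  simp [pi11Set, sigma11Set]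

theorem exists_ceSet_eq {α : Type*} [Primcodable α] {P : α → Prop} (hP : REPred P) :
    ∃ c, ∀ a, Encodable.encode a ∈ ceSet c ↔ P a := by
  obtain ⟨c, hc⟩ := Nat.Partrec.Code.exists_code.1 hP
  refine ⟨Encodable.encode c, fun a => ?_⟩
  simp [ceSet, hc, Part.assert]

/-- The decoding of a number as an element of `α`, with a default value. -/
def decodeD (α : Type*) [Primcodable α] [Inhabited α] (a : ℕ) : α :=
  (Encodable.decode a).getD default

theorem decodeD_encode {α : Type*} [Primcodable α] [Inhabited α] (a : α) :
    decodeD α (Encodable.encode a) = a := by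
  simp [decodeD]

theorem primrec_decodeD (α : Type*) [Primcodable α] [Inhabited α] : Primrec (decodeD α) :=
  Primrec.option_getD.comp .decode (.const _)

/-- The `m`-th of the sequences that are coded by `g` from its second entry on. -/
def Baire.column (g : Baire) (m : ℕ) : Baire := fun i => g (Nat.pair m i + 1)

/-- Amalgamates countably many witnesses, which turns `∀ m ∃ f` into `∃ g ∀ m`. -/
theorem Baire.exists_column_eq (a : ℕ) (F : ℕ → Baire) :
    ∃ g : Baire, g 0 = a ∧ ∀ m, g.column m = F m :=
  ⟨Baire.cons a fun j => F j.unpair.1 j.unpair.2, rfl, fun m => by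
    funext i
    simp [Baire.column, Baire.cons]⟩

/-- The finite approximations to the condition
`E n a → ∃ m, D n a m ∧ (m, g.column m, x.tail) ∈ sigma01Set (x 0)` with `a` coded by `g 0`: the
length of the initial segments of `g` and `x` codes `m` and the number of computation steps. -/
def approxPred {α : Type*} [Primcodable α] [Inhabited α] (E : ℕ → α → Prop)
    (D : ℕ → α → ℕ → Prop) (t : ℕ × List ℕ × List ℕ) : Prop :=
  t.2.1 ≠ [] ∧ (E t.1 (decodeD α t.2.1.headI) →
    D t.1 (decodeD α t.2.1.headI) t.2.1.length.pred.unpair.1 ∧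
    (Nat.Partrec.Code.evaln t.2.1.length.pred.unpair.2.unpair.2
      (Denumerable.ofNat Nat.Partrec.Code t.2.2.headI)
      (Encodable.encode (t.2.1.length.pred.unpair.1,
        (List.range t.2.1.length.pred.unpair.2.unpair.1).map
          (fun i => t.2.1.getD (Nat.pair t.2.1.length.pred.unpair.1 i + 1) 0),
        (List.range t.2.1.length.pred.unpair.2.unpair.1).map
          (fun i => t.2.2.getD (i + 1) 0)))).isSome = true)

theorem primrecPred_approxPred {α : Type*} [Primcodable α] [Inhabited α] {E : ℕ → α → Prop}
    {D : ℕ → α → ℕ → Prop} (hE : PrimrecRel E)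
    (hD : PrimrecPred fun t : ℕ × α × ℕ => D t.1 t.2.1 t.2.2) :
    PrimrecPred (approxPred E D) := by
  have hσ : Primrec fun t : ℕ × List ℕ × List ℕ => t.2.1 := Primrec.fst.comp .snd
  have hτ : Primrec fun t : ℕ × List ℕ × List ℕ => t.2.2 := Primrec.snd.comp .snd
  have ha : Primrec fun t : ℕ × List ℕ × List ℕ => decodeD α t.2.1.headI :=
    (primrec_decodeD α).comp (Primrec.list_headI.comp hσ)
  have hK : Primrec fun t : ℕ × List ℕ × List ℕ => t.2.1.length.pred.unpair :=
    Primrec.unpair.comp (Primrec.pred.comp (Primrec.list_length.comp hσ))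
  have hm : Primrec fun t : ℕ × List ℕ × List ℕ => t.2.1.length.pred.unpair.1 :=
    Primrec.fst.comp hK
  have hks := Primrec.unpair.comp (Primrec.snd.comp hK)
  have hk := Primrec.fst.comp hks
  have hs := Primrec.snd.comp hks
  have hf : Primrec fun t : ℕ × List ℕ × List ℕ =>
      (List.range t.2.1.length.pred.unpair.2.unpair.1).map
        (fun i => t.2.1.getD (Nat.pair t.2.1.length.pred.unpair.1 i + 1) 0) :=
    Primrec.list_map (Primrec.list_range.comp hk) <|
      (Primrec.list_getD 0).comp (hσ.comp .fst)
        (Primrec.succ.comp (Primrec₂.natPair.comp (hm.comp .fst) .snd))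
  have hp : Primrec fun t : ℕ × List ℕ × List ℕ =>
      (List.range t.2.1.length.pred.unpair.2.unpair.1).map (fun i => t.2.2.getD (i + 1) 0) :=
    Primrec.list_map (Primrec.list_range.comp hk) <|
      (Primrec.list_getD 0).comp (hτ.comp .fst) (Primrec.succ.comp .snd)
  have hcode := (Primrec.ofNat Nat.Partrec.Code).comp (Primrec.list_headI.comp hτ)
  have heval := Nat.Partrec.Code.primrec_evaln.comp
    ((hs.pair hcode).pair (Primrec.encode.comp (hm.pair (hf.pair hp))))
  have hne : PrimrecPred fun t : ℕ × List ℕ × List ℕ => t.2.1 ≠ [] :=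
    (Primrec.eq.comp hσ (.const [])).not
  have hsome := Primrec.eq.comp (Primrec.option_isSome.comp heval) (.const true)
  have hEa := hE.comp Primrec.fst ha
  have hDa := hD.comp (Primrec.fst.pair (ha.pair hm))
  exact (hne.and (hEa.not.or (hDa.and hsome))).of_eq fun t => by
    simp only [approxPred, imp_iff_not_or]

/-- Each triple `(m, k, s)` is tested at exactly one length `K = pair m (pair k s) + 1`, so no
monotonicity in `K` is needed. This `K` is large enough: the entries used sit at `0`, `pair m i + 1`
and `i + 1` with `i < k`, all below `K`. -/
theorem exists_approxPred_restrict_iff {α : Type*} [Primcodable α] [Inhabited α]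
    (E : ℕ → α → Prop) (D : ℕ → α → ℕ → Prop) (n : ℕ) (g x : Baire) :
    (∃ K, approxPred E D (n, g.restrict K, x.restrict K)) ↔
      (E n (decodeD α (g 0)) →
        ∃ m, D n (decodeD α (g 0)) m ∧ (m, g.column m, x.tail) ∈ sigma01Set (x 0)) := by
  have hrestrict : ∀ (y : Baire) (i K : ℕ), i < K → (y.restrict K).getD i 0 = y i := by
    intro y i K hi
    simp [Baire.restrict, List.getD_eq_getElem?_getD, hi]
  have hhead : ∀ (y : Baire) (K : ℕ), (y.restrict (K + 1)).headI = y 0 := by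
    intro y K
    simp [Baire.restrict, List.range_succ_eq_map]
  have key : ∀ m k s, approxPred E D (n, g.restrict (Nat.pair m (Nat.pair k s) + 1),
      x.restrict (Nat.pair m (Nat.pair k s) + 1)) ↔ (E n (decodeD α (g 0)) →
        D n (decodeD α (g 0)) m ∧ (Nat.Partrec.Code.evaln s
          (Denumerable.ofNat Nat.Partrec.Code (x 0))
          (Encodable.encode (m, (g.column m).restrict k, x.tail.restrict k))).isSome = true) := by
    intro m k s
    have hlen : (g.restrict (Nat.pair m (Nat.pair k s) + 1)).length.pred
        = Nat.pair m (Nat.pair k s) := by simp [Baire.restrict]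
    have hne : g.restrict (Nat.pair m (Nat.pair k s) + 1) ≠ [] := by simp [Baire.restrict]
    have hg : (List.range k).map (fun i =>
        (g.restrict (Nat.pair m (Nat.pair k s) + 1)).getD (Nat.pair m i + 1) 0)
        = (g.column m).restrict k := by
      refine List.map_congr_left fun i hi => hrestrict _ _ _ (Nat.succ_lt_succ ?_)
      exact Nat.pair_lt_pair_right m
        ((List.mem_range.1 hi).trans_le (Nat.left_le_pair k s))
    have hx : (List.range k).map (fun i =>
        (x.restrict (Nat.pair m (Nat.pair k s) + 1)).getD (i + 1) 0) = x.tail.restrict k := by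
      refine List.map_congr_left fun i hi => hrestrict _ _ _ (Nat.succ_lt_succ ?_)
      exact (List.mem_range.1 hi).trans_le
        ((Nat.left_le_pair k s).trans (Nat.right_le_pair m _))
    simp only [approxPred, hlen, hhead, Nat.unpair_pair, hg, hx, ne_eq, hne, not_false_eq_true,
      true_and]
  constructor
  · rintro ⟨K, hK⟩ hE
    obtain _ | K := K
    -- For `K = 0` the heads would be default values unrelated to `g 0` and `x 0`; the nonemptiness
    -- clause excludes this.
    · exact absurd rfl hK.1
    obtain ⟨m, j, rfl⟩ : ∃ m j, K = Nat.pair m j := ⟨_, _, (Nat.pair_unpair K).symm⟩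
    obtain ⟨k, s, rfl⟩ : ∃ k s, j = Nat.pair k s := ⟨_, _, (Nat.pair_unpair j).symm⟩
    obtain ⟨hD, hs⟩ := (key m k s).1 hK hE
    obtain ⟨v, hv⟩ := Option.isSome_iff_exists.1 hs
    exact ⟨m, hD, k, Part.dom_iff_mem.2 ⟨v, Nat.Partrec.Code.evaln_sound hv⟩⟩
  · intro h
    by_cases hE : E n (decodeD α (g 0))
    · obtain ⟨m, hD, k, hk⟩ := h hE
      obtain ⟨v, hv⟩ := Part.dom_iff_mem.1 hk
      obtain ⟨s, hs⟩ := Nat.Partrec.Code.evaln_complete.1 hv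
      exact ⟨_, (key m k s).2 fun _ => ⟨hD, Option.isSome_iff_exists.2 ⟨v, hs⟩⟩⟩
    · exact ⟨_, (key 0 0 0).2 fun h => absurd h hE⟩

/-- Uniformly in a `Σ¹₁` set `A`, the condition that there is `a` with `E n a` such that `A`
contains all `m` with `D n a m` defines a `Σ¹₁` set. -/
theorem exists_sigma11Set_eq {α : Type*} [Primcodable α] [Inhabited α] {E : ℕ → α → Prop}
    {D : ℕ → α → ℕ → Prop} (hE : PrimrecRel E)
    (hD : PrimrecPred fun t : ℕ × α × ℕ => D t.1 t.2.1 t.2.2) :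
    ∃ c, ∀ x : Baire, sigma11Set c x =
      {n | ∃ a, E n a ∧ ∀ m, D n a m → m ∈ sigma11Set (x 0) x.tail} := by
  -- The index is fixed before `x`: the index `x 0` of the given set is read from the oracle.
  obtain ⟨c, hc⟩ := exists_ceSet_eq (primrecPred_approxPred hE hD).computablePred.to_re
  refine ⟨c, fun x => Set.ext fun n => ?_⟩
  have hmem : n ∈ sigma11Set c x ↔
      ∃ g : Baire, ¬ ∃ K, approxPred E D (n, g.restrict K, x.restrict K) :=
    exists_congr fun g => not_congr (exists_congr fun K => hc _)
  rw [hmem]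
  simp only [exists_approxPred_restrict_iff, Set.mem_ofPred_eq]
  push Not
  constructor
  · rintro ⟨g, hg, h⟩
    exact ⟨_, hg, fun m hm => ⟨_, h m hm⟩⟩
  · rintro ⟨a, ha, h⟩
    choose! F hF using h
    obtain ⟨g, hg, hgF⟩ := Baire.exists_column_eq (Encodable.encode a) F
    rw [← decodeD_encode a, ← hg] at ha
    refine ⟨g, ha, fun m hm => ?_⟩
    rw [hg, decodeD_encode] at hm
    rw [hgF]
    exact hF m hm

/-! ### The reductions -/

theorem ncard_eq_sInf_ncard_le {A : Set ℕ} : A.ncard = sInf {n | A.ncard ≤ n} :=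
  (csInf_Ici (a := A.ncard)).symm

/-- The set is the initial segment below `min A`. -/
theorem ncard_setOf_forall_le_notMem {A : Set ℕ} (hA : A.Nonempty) :
    {n | ∀ m ≤ n, m ∉ A}.Finite ∧ {n | ∀ m ≤ n, m ∉ A}.ncard = sInf A := by
  have h : {n | ∀ m ≤ n, m ∉ A} = Set.Iio (sInf A) := by
    ext n
    refine ⟨fun h => ?_, fun h m hm => Nat.notMem_of_lt_sInf (hm.trans_lt h)⟩
    by_contra hn
    exact h _ (not_lt.1 hn) (Nat.sInf_mem hA)
  rw [h]
  exact ⟨Set.finite_Iio _, by simp [Set.ncard_eq_toFinset_card']⟩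

theorem lt_ncard_iff_exists_list {A : Set ℕ} (hA : A.Finite) {n : ℕ} :
    n < A.ncard ↔ ∃ l : List ℕ, (l.length = n + 1 ∧ l.Nodup) ∧ ∀ m ∈ l, m ∈ A := by
  constructor
  · intro h
    obtain ⟨B, hBA, hB⟩ := Set.exists_subset_card_eq (Nat.succ_le_of_lt h)
    have hfin := hA.subset hBA
    refine ⟨hfin.toFinset.toList, ⟨?_, Finset.nodup_toList _⟩, fun m hm => hBA (by simpa using hm)⟩
    rw [Finset.length_toList, ← Set.ncard_eq_toFinset_card _ hfin, hB]
  · rintro ⟨l, ⟨hl, hnd⟩, hlA⟩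
    have h := Set.ncard_le_ncard (s := (l.toFinset : Set ℕ))
      (fun m hm => hlA m (by simpa using hm)) hA
    rw [Set.ncard_coe_finset, List.toFinset_card_of_nodup hnd] at h
    omega

/-- The list only has to cover `A`, so the condition involves `A` through its complement alone;
repetitions are harmless. -/
theorem ncard_le_iff_exists_list {A : Set ℕ} (hA : A.Finite) {n : ℕ} :
    A.ncard ≤ n ↔ ∃ l : List ℕ, l.length ≤ n ∧ ∀ m, m ∉ l → m ∉ A := by
  constructor
  · intro h
    refine ⟨hA.toFinset.toList, ?_, fun m hm => by simpa using hm⟩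
    rwa [Finset.length_toList, ← Set.ncard_eq_toFinset_card _ hA]
  · rintro ⟨l, hl, hlA⟩
    have h := Set.ncard_le_ncard (t := (l.toFinset : Set ℕ))
      (fun m hm => by simpa using not_imp_not.1 (hlA m) hm) (Finset.finite_toSet _)
    rw [Set.ncard_coe_finset] at h
    exact h.trans ((List.toFinset_card_le l).trans hl)

theorem primrecRel_mem_list : PrimrecRel fun (m : ℕ) (l : List ℕ) => m ∈ l :=
  (Primrec.nat_lt.comp (Primrec.list_idxOf.comp .fst .snd) (Primrec.list_length.comp .snd)).of_eq
    fun _ => List.idxOf_lt_length_iff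

/-- A list has no repetitions iff each position is the first occurrence of its entry, a bounded
condition. -/
theorem primrecPred_nodup : PrimrecPred fun l : List ℕ => l.Nodup := by
  have hR : PrimrecRel fun (i : ℕ) (l : List ℕ) => l.idxOf (l.getD i 0) = i :=
    Primrec.eq.comp (Primrec.list_idxOf.comp ((Primrec.list_getD 0).comp .snd .fst) .snd) .fst
  have h := hR.forall_mem_list.comp (Primrec.list_range.comp Primrec.list_length) Primrec.id
  refine h.of_eq fun l => ?_
  simp only [List.mem_range, id]
  constructor
  · intro h
    refine List.nodup_iff_injective_getElem.2 fun i j hij => Fin.ext ?_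
    rw [← h i i.2, ← h j j.2]
    simpa using congrArg (l.idxOf ·) hij
  · intro h i hi
    simpa [hi] using h.idxOf_getElem i hi

theorem pi11LNP_le_sigma11Counting : WeihrauchLE pi11LNP sigma11Counting := by
  -- Nothing is guessed here, so `a` is a dummy. Read as a `Σ¹₁` name, the name of `A` denotes its
  -- complement.
  obtain ⟨c, hc⟩ := exists_sigma11Set_eq (α := ℕ) (E := fun _ _ => True) (D := fun n _ m => m ≤ n)
    ⟨inferInstance, .const true⟩ (Primrec.nat_le.comp (Primrec.snd.comp .snd) .fst)
  refine weihrauchLE_of_cons c ?_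
  rintro p A hp hA
  obtain rfl := Part.mem_some_iff.1 hp
  have hset : sigma11Set c p = {n | ∀ m ≤ n, m ∉ pi11Set (p 0) p.tail} := by
    rw [hc]
    simp [mem_pi11Set_iff]
  obtain ⟨hfin, hcard⟩ := ncard_setOf_forall_le_notMem hA
  rw [← hset] at hfin hcard
  refine ⟨_, Part.mem_some _, hfin, ?_⟩
  rintro _ ⟨-, rfl⟩
  exact ⟨hA, hcard.symm⟩

theorem sigma11LNP_le_pi11Counting : WeihrauchLE sigma11LNP pi11Counting := by
  -- This `Σ¹₁` condition says that some `a ≤ n` is in `A`; the set to be counted is its complement.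
  obtain ⟨c, hc⟩ := exists_sigma11Set_eq (α := ℕ) (E := fun n a => a ≤ n) (D := fun _ a m => m = a)
    (Primrec.nat_le.comp .snd .fst)
    (Primrec.eq.comp (Primrec.snd.comp .snd) (Primrec.fst.comp .snd))
  refine weihrauchLE_of_cons c ?_
  rintro p A hp hA
  obtain rfl := Part.mem_some_iff.1 hp
  have hset : pi11Set c p = {n | ∀ m ≤ n, m ∉ sigma11Set (p 0) p.tail} := by
    ext n
    rw [mem_pi11Set_iff, hc]
    simp
  obtain ⟨hfin, hcard⟩ := ncard_setOf_forall_le_notMem hA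
  rw [← hset] at hfin hcard
  refine ⟨_, Part.mem_some _, hfin, ?_⟩
  rintro _ ⟨-, rfl⟩
  exact ⟨hA, hcard.symm⟩

theorem sigma11Counting_le_pi11LNP : WeihrauchLE sigma11Counting pi11LNP := by
  -- The `Σ¹₁` condition is `n < #A`; its complement is the instance of `Π¹₁-LNP`.
  obtain ⟨c, hc⟩ := exists_sigma11Set_eq (α := List ℕ)
    (E := fun n l => l.length = n + 1 ∧ l.Nodup) (D := fun _ l m => m ∈ l)
    ((Primrec.eq.comp (Primrec.list_length.comp .snd) (Primrec.succ.comp .fst)).and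
      (primrecPred_nodup.comp .snd))
    (primrecRel_mem_list.comp (Primrec.snd.comp .snd) (Primrec.fst.comp .snd))
  refine weihrauchLE_of_cons c ?_
  rintro p A hp hA
  obtain rfl := Part.mem_some_iff.1 hp
  have hset : pi11Set c p = {n | (sigma11Set (p 0) p.tail).ncard ≤ n} := by
    ext n
    rw [mem_pi11Set_iff, hc]
    exact not_iff_comm.1 (not_le.trans (lt_ncard_iff_exists_list hA))
  refine ⟨_, Part.mem_some _, ⟨(sigma11Set (p 0) p.tail).ncard, hset.symm.subset (by simp)⟩, ?_⟩
  rintro _ ⟨-, rfl⟩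
  refine ⟨hA, ?_⟩
  exact ncard_eq_sInf_ncard_le.trans (congrArg sInf hset.symm)

theorem pi11Counting_le_sigma11LNP : WeihrauchLE pi11Counting sigma11LNP := by
  obtain ⟨c, hc⟩ := exists_sigma11Set_eq (α := List ℕ)
    (E := fun n l => l.length ≤ n) (D := fun _ l m => m ∉ l)
    (Primrec.nat_le.comp (Primrec.list_length.comp .snd) .fst)
    (primrecRel_mem_list.comp (Primrec.snd.comp .snd) (Primrec.fst.comp .snd)).not
  refine weihrauchLE_of_cons c ?_
  rintro p A hp hA
  obtain rfl := Part.mem_some_iff.1 hp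
  have hset : sigma11Set c p = {n | (pi11Set (p 0) p.tail).ncard ≤ n} := by
    rw [hc]
    ext n
    refine Iff.trans ?_ (ncard_le_iff_exists_list hA).symm
    simp [mem_pi11Set_iff]
  refine ⟨_, Part.mem_some _, ⟨(pi11Set (p 0) p.tail).ncard, hset.symm.subset (by simp)⟩, ?_⟩
  rintro _ ⟨-, rfl⟩
  refine ⟨hA, ?_⟩
  exact ncard_eq_sInf_ncard_le.trans (congrArg sInf hset.symm)

theorem mainTheorem10 :
    WeihrauchEquiv pi11LNP sigma11Counting ∧ WeihrauchEquiv sigma11LNP pi11Counting :=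
  ⟨⟨pi11LNP_le_sigma11Counting, sigma11Counting_le_pi11LNP⟩,
    ⟨sigma11LNP_le_pi11Counting, pi11Counting_le_sigma11LNP⟩⟩
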